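/- All algebras are complex, commutative and unital, with $\|1\|=1$ and $\|ab\|\le\|a\|\,\|b\|$ in the normed case (completeness is not assumed); homomorphisms and subalgebras are unital. A normed algebra is *tractable* if the intersection of its closed maximal ideals is $\{0\}$. Let $R$ be a normed algebra, $f(x)=a_0+\dots+a_{n-1}x^{n-1}+x^n\in R[x]$ monic, and let $t>0$ satisfy $\|a_0\|+\|a_1\|t+\dots+\|a_{n-1}\|t^{n-1}\le t^n$. The *Arens–Hoffman norm* with parameter $t$ on $R[x]/(f(x))$ is the quotient norm induced by $\bigl\|\sum_k c_kx^k\bigr\|=\sum_k\|c_k\|t^k$ on $R[x]$. Let $A$ be a normed algebra and $U\subseteq A[x]$ a non-empty set of monic polynomials. A *standard normed extension* of $A$ generated by $U$ is a normed algebra $B$ containing $A$ isometrically as a subalgebra, for which there exist a well-ordering $\le$ of $U$ with least element $\alpha_0$, subalgebras $A\subseteq B_\alpha\subseteq B$ $(\alpha\in U)$, isomorphisms $\varphi_\alpha$ and numbers $t_\alpha>0$ such that 1. $B=\bigcup_{\alpha\in U}B_\alpha$, and $B_\alpha\subseteq B_\beta$ whenever $\alpha\le\beta$; 2. for each $\alpha\in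 U$, setting $A_{\alpha_0}=A$ and $A_\alpha=\bigcup_{\beta<\alpha}B_\beta$ for $\alpha>\alpha_0$, $\varphi_\alpha\colon B_\alpha\to A_\alpha[x]/(\alpha(x))$ is an algebra isomorphism whose restriction to $A_\alpha$ is the canonical embedding $A_\alpha\to A_\alpha[x]/(\alpha(x))$; 3. for each $\alpha\in U$, $t_\alpha$ is an admissible parameter for $\alpha(x)$ as above, and $\varphi_\alpha$ is an isometry when $A_\alpha$ and $B_\alpha$ carry the norm of $B$ and $A_\alpha[x]/(\alpha(x))$ carries the Arens–Hoffman norm with parameter $t_\alpha$. **Theorem 5.12.** Let $B$ be a standard normed extension of $A$ generated by $U$. Suppose that for every $\alpha\in U$ the discriminant $\operatorname{discr}(\alpha)\in A$ is neither zero nor a zero divisor in $A$. If $A$ is tractable, then $B$ is tractable. -/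

import Mathlib

open Polynomial

noncomputable section

/-- A commutative unital normed algebra is tractable if the intersection of its closed maximal
ideals is zero. -/
def IsTractable (A : Type*) [NormedCommRing A] : Prop :=
  sInf {I : Ideal A | I.IsMaximal ∧ IsClosed (I : Set A)} = ⊥

section ArensHoffman

variable {R : Type*} [CommRing R] [Norm R]

/-- `t` is an admissible Arens–Hoffman parameter for the monic polynomial
`f = a₀ + ⋯ + aₙ₋₁ xⁿ⁻¹ + xⁿ`: it is positive and `‖a₀‖ + ‖a₁‖ t + ⋯ + ‖aₙ₋₁‖ tⁿ⁻¹ ≤ tⁿ`. -/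
def IsArensHoffmanParameter (f : R[X]) (t : ℝ) : Prop :=
  0 < t ∧ ∑ k ∈ Finset.range f.natDegree, ‖f.coeff k‖ * t ^ k ≤ t ^ f.natDegree

/-- The norm `‖∑ cₖ xᵏ‖ = ∑ ‖cₖ‖ tᵏ` on `R[x]`. -/
def weightedPolyNorm (t : ℝ) (p : R[X]) : ℝ :=
  ∑ k ∈ p.support, ‖p.coeff k‖ * t ^ k

/-- The Arens–Hoffman norm with parameter `t` on `R[x] / (f)`: the quotient (infimum) norm induced
by the weighted norm on `R[x]`. -/
def arensHoffmanNorm (f : R[X]) (t : ℝ) (q : AdjoinRoot f) : ℝ :=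
  ⨅ p : {p : R[X] // AdjoinRoot.mk f p = q}, weightedPolyNorm t p.1

end ArensHoffman

section Standard

variable {A B : Type*} [CommRing A] [Algebra ℂ A] [CommRing B] [Algebra ℂ B]

/-- For subalgebras `(B_α)` of `B` indexed by a set `ι` ordered by `r`, the subalgebra `A_α` of `B`:
the (embedded) algebra `A` if `α` is least, and the union of the `B_β`, `β < α`, otherwise. It is
written here as a supremum of subalgebras; `mem_lowerStage_least` and `mem_lowerStage` show that
for increasing families of algebras containing `A` it is the algebra just described. -/
def lowerStage {ι : Type*} (θ : A →ₐ[ℂ] B) (r : ι → ι → Prop) (stage : ι → Subalgebra ℂ B)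
    (α : ι) : Subalgebra ℂ B :=
  θ.range ⊔ ⨆ β : {β : ι // r β α}, stage β

/-- A polynomial over `A`, regarded as a polynomial over `A_α`. -/
def lowerPoly {ι : Type*} (θ : A →ₐ[ℂ] B) (r : ι → ι → Prop) (stage : ι → Subalgebra ℂ B)
    (α : ι) (f : A[X]) : (lowerStage θ r stage α)[X] :=
  f.map (θ.codRestrict (lowerStage θ r stage α)
    (fun a => (le_sup_left : θ.range ≤ lowerStage θ r stage α) ⟨a, rfl⟩)).toRingHom

theorem mem_lowerStage_least {ι : Type*} (θ : A →ₐ[ℂ] B) (r : ι → ι → Prop)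
    (stage : ι → Subalgebra ℂ B) (α : ι) (hα : ∀ β, ¬ r β α) (b : B) :
    b ∈ lowerStage θ r stage α ↔ ∃ a, θ a = b := by
  have : IsEmpty {β : ι // r β α} := ⟨fun β => hα β.1 β.2⟩
  simp [lowerStage]

theorem mem_lowerStage {ι : Type*} (θ : A →ₐ[ℂ] B) (r : ι → ι → Prop) [IsWellOrder ι r]
    (stage : ι → Subalgebra ℂ B) (hA : ∀ α, θ.range ≤ stage α)
    (hmono : ∀ α β, r α β → stage α ≤ stage β) (α : ι) (hα : ∃ β, r β α) (b : B) :
    b ∈ lowerStage θ r stage α ↔ ∃ β, r β α ∧ b ∈ stage β := by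
  obtain ⟨β₀, hβ₀⟩ := hα
  have : Nonempty {β : ι // r β α} := ⟨⟨β₀, hβ₀⟩⟩
  have hdir : Directed (· ≤ ·) (fun β : {β : ι // r β α} => stage β) := by
    intro x y
    rcases trichotomous_of r x.1 y.1 with h | h | h
    · exact ⟨y, hmono _ _ h, le_rfl⟩
    · exact ⟨y, (congrArg stage h).le, le_rfl⟩
    · exact ⟨x, le_rfl, hmono _ _ h⟩
  have hle : θ.range ≤ ⨆ β : {β : ι // r β α}, stage β :=
    (hA β₀).trans (le_iSup (fun β : {β : ι // r β α} => stage β) ⟨β₀, hβ₀⟩)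
  rw [lowerStage, sup_eq_right.mpr hle, ← SetLike.mem_coe, Subalgebra.coe_iSup_of_directed hdir]
  simp

/-- The structure of a standard extension on `B`, regarded as an extension of `A` through the unital
monomorphism `θ`, with respect to a set `U` of monic polynomials over `A`: a well-ordering of `U`
(given by its strict order `lt`), intermediate subalgebras `B_α = stage α` and isomorphisms
`φ_α = iso α` of `B_α` with `A_α[x] / (α(x))` over `A_α`. -/
structure StandardExtension (θ : A →ₐ[ℂ] B) (U : Set A[X]) where
  injective : Function.Injective θ
  monic : ∀ α ∈ U, α.Monic
  lt : U → U → Prop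
  isWellOrder : IsWellOrder U lt
  stage : U → Subalgebra ℂ B
  range_le_stage : ∀ α, θ.range ≤ stage α
  iUnion_stage : ⋃ α, (stage α : Set B) = Set.univ
  stage_mono : ∀ α β, lt α β → stage α ≤ stage β
  iso : ∀ α : U, stage α ≃ₐ[ℂ] AdjoinRoot (lowerPoly θ lt stage α α.1)
  /-- `φ_α` restricts on `A_α` (which is contained in `B_α`) to the canonical embedding. -/
  iso_apply_lower : ∀ (α : U) (a : lowerStage θ lt stage α) (b : stage α), (b : B) = (a : B) →
    iso α b = AdjoinRoot.of (lowerPoly θ lt stage α α.1) a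

end Standard

/-- The structure of a standard normed extension on the normed algebra `B`, regarded as an isometric
extension of `A` through `θ`, generated by `U`: a standard extension in which every `φ_α` is an
isometry of `B_α` onto `A_α[x] / (α(x))` with an Arens–Hoffman norm, where `A_α` and `B_α` have the
norm of `B`. -/
structure StandardNormedExtension {A B : Type*} [NormedCommRing A] [NormedAlgebra ℂ A]
    [NormedCommRing B] [NormedAlgebra ℂ B] (θ : A →ₐ[ℂ] B) (U : Set A[X])
    extends StandardExtension θ U where
  isometry : Isometry θ
  parameter : U → ℝ
  isParameter : ∀ α : U,
    IsArensHoffmanParameter (lowerPoly θ lt stage α α.1) (parameter α)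
  norm_iso : ∀ (α : U) (b : stage α),
    arensHoffmanNorm (lowerPoly θ lt stage α α.1) (parameter α) (iso α b) = ‖(b : B)‖

end

/-! Tractability amounts to separation of points by contractive characters, so the task is to find
enough such characters on `B`. As `B` is integral over `A`, every character of `A` extends to `B`.
If it is contractive on `A`, every extension is contractive: admissibility of `t_α` bounds the image
of each adjoined root by `t_α` (`norm_algHom_le`). Separation (`eq_zero_of_forall_algHom`) goes by
transfinite induction. Write `b ∈ B_α` as `q(root)` with `deg q < deg α`. A character not killing
`discr α` turns `α` into a separable polynomial. Each of its roots is the value at `root` of a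
character with the same restriction to `A_α`, so the image of `q` has too many zeros and vanishes.
Hence `discr α` times any coefficient of `q` is killed by all relevant characters and is zero by
induction; `discr α` can be cancelled. -/

open Polynomial

/-! ### Extension of characters; tractability through contractive characters -/

section Characters

/-- Lying over gives a maximal ideal above `ker χ`; its residue field is integral over `ℂ`, hence
equal to `ℂ`. -/
theorem AlgHom.exists_extension_of_isIntegral {S B : Type*} [CommRing S] [Algebra ℂ S]
    [CommRing B] [Algebra ℂ B] (i : S →ₐ[ℂ] B) (hinj : Function.Injective i)
    (hint : (i : S →+* B).IsIntegral) (χ : S →ₐ[ℂ] ℂ) :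
    ∃ ψ : B →ₐ[ℂ] ℂ, ∀ s, ψ (i s) = χ s := by
  let _ : Algebra S B := (i : S →+* B).toAlgebra
  have : Algebra.IsIntegral S B := ⟨hint⟩
  have hsurj : Function.Surjective χ := fun z =>
    ⟨algebraMap ℂ S z, by rw [AlgHom.commutes]; rfl⟩
  have hmax : (RingHom.ker χ).IsMaximal := RingHom.ker_isMaximal_of_surjective χ hsurj
  obtain ⟨Q, hQ, hQP⟩ := Ideal.exists_ideal_over_maximal_of_isIntegral (S := B) (RingHom.ker χ)
    (by
      rw [(RingHom.injective_iff_ker_eq_bot (algebraMap S B)).mp hinj]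
      exact bot_le)
  let _ : Field (B ⧸ Q) := Ideal.Quotient.field Q
  have hcomp : (algebraMap ℂ (B ⧸ Q)).comp (χ : S →+* ℂ) =
      (Ideal.Quotient.mk Q).comp (i : S →+* B) := by
    ext s
    have hs : s - algebraMap ℂ S (χ s) ∈ RingHom.ker χ := by
      rw [RingHom.mem_ker, map_sub, AlgHom.commutes]
      exact sub_self _
    rw [← hQP, Ideal.mem_comap] at hs
    have h2 : i (s - algebraMap ℂ S (χ s)) ∈ Q := hs
    rw [map_sub, AlgHom.commutes] at h2
    exact (Ideal.Quotient.eq.mpr h2).symm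
  have hI : (algebraMap ℂ (B ⧸ Q)).IsIntegral := by
    refine RingHom.IsIntegral.tower_top (χ : S →+* ℂ) _ ?_
    rw [hcomp]
    exact RingHom.IsIntegral.trans _ _ hint
      (RingHom.isIntegral_of_surjective _ Ideal.Quotient.mk_surjective)
  have hbij := IsAlgClosed.ringHom_bijective_of_isIntegral _ hI
  let e : ℂ ≃ₐ[ℂ] (B ⧸ Q) := AlgEquiv.ofBijective (Algebra.ofId ℂ (B ⧸ Q)) hbij
  refine ⟨(e.symm : (B ⧸ Q) →ₐ[ℂ] ℂ).comp (Ideal.Quotient.mkₐ ℂ Q), fun s => ?_⟩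
  change e.symm (Ideal.Quotient.mk Q (i s)) = χ s
  rw [AlgEquiv.symm_apply_eq]
  exact (RingHom.congr_fun hcomp s).symm

theorem exists_contractive_algHom_of_complete (R : Type*) [NormedCommRing R] [NormedAlgebra ℂ R]
    [CompleteSpace R] [Nontrivial R] (hone : ‖(1 : R)‖ ≤ 1) :
    ∃ χ : R →ₐ[ℂ] ℂ, ∀ a, ‖χ a‖ ≤ ‖a‖ := by
  obtain ⟨ρ⟩ : Nonempty (WeakDual.characterSpace ℂ R) := inferInstance
  refine ⟨WeakDual.CharacterSpace.equivAlgHom ρ, fun x => ?_⟩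
  have h := (WeakDual.toStrongDual (ρ : WeakDual ℂ R)).le_of_opNorm_le
    ((WeakDual.CharacterSpace.norm_le_norm_one ρ).trans hone) x
  rwa [one_mul] at h

/-- The completion is a nonzero Banach algebra, so it has a character, which restricts to `Q`. -/
theorem exists_contractive_algHom (Q : Type*) [NormedCommRing Q] [NormedAlgebra ℂ Q]
    [Nontrivial Q] (hone : ‖(1 : Q)‖ ≤ 1) : ∃ χ : Q →ₐ[ℂ] ℂ, ∀ a, ‖χ a‖ ≤ ‖a‖ := by
  have : Nontrivial (UniformSpace.Completion Q) :=
    (UniformSpace.Completion.coe_injective Q).nontrivial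
  obtain ⟨ρ', hρ⟩ := exists_contractive_algHom_of_complete (UniformSpace.Completion Q)
    (by rwa [← UniformSpace.Completion.coe_one, UniformSpace.Completion.norm_coe])
  refine ⟨AlgHom.mk' ((ρ' : UniformSpace.Completion Q →+* ℂ).comp
    UniformSpace.Completion.coeRingHom) fun z x => ?_, fun a => ?_⟩
  · change ρ' ((z • x : Q) : UniformSpace.Completion Q) = z • ρ' (x : UniformSpace.Completion Q)
    rw [UniformSpace.Completion.coe_smul, map_smul]
  · change ‖ρ' (a : UniformSpace.Completion Q)‖ ≤ ‖a‖
    rw [← UniformSpace.Completion.norm_coe a]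
    exact hρ _

theorem Ideal.exists_contractive_algHom {A : Type*} [NormedCommRing A] [NormedAlgebra ℂ A]
    [NormOneClass A] (M : Ideal A) (hM : M.IsMaximal) (hc : IsClosed (M : Set A)) :
    ∃ χ : A →ₐ[ℂ] ℂ, (∀ a, ‖χ a‖ ≤ ‖a‖) ∧ ∀ a, χ a = 0 → a ∈ M := by
  have : IsClosed (M : Set A) := hc
  have : Nontrivial (A ⧸ M) := Ideal.Quotient.nontrivial_iff.mpr hM.ne_top
  obtain ⟨χ, hχ⟩ := _root_.exists_contractive_algHom (A ⧸ M)
    ((Submodule.Quotient.norm_mk_le M (1 : A)).trans norm_one.le)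
  refine ⟨χ.comp (Ideal.Quotient.mkₐ ℂ M),
    fun a => (hχ _).trans (Submodule.Quotient.norm_mk_le M a), fun a ha => ?_⟩
  -- Outside `M` the element is invertible modulo `M`, so a character of the quotient cannot kill
  -- it.
  by_contra hna
  obtain ⟨b, hb⟩ := Ideal.Quotient.exists_inv (I := M)
    (a := Ideal.Quotient.mk M a) (fun h => hna (Ideal.Quotient.eq_zero_iff_mem.mp h))
  have h1 := congrArg χ hb
  rw [map_mul, map_one] at h1
  change χ (Ideal.Quotient.mk M a) = 0 at ha
  simp [ha] at h1

theorem IsTractable.eq_zero_of_forall_algHom {A : Type*} [NormedCommRing A] [NormedAlgebra ℂ A]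
    [NormOneClass A] (hA : IsTractable A) (a : A)
    (ha : ∀ χ : A →ₐ[ℂ] ℂ, (∀ x, ‖χ x‖ ≤ ‖x‖) → χ a = 0) : a = 0 := by
  have : a ∈ sInf {I : Ideal A | I.IsMaximal ∧ IsClosed (I : Set A)} := by
    rw [Submodule.mem_sInf]
    rintro M ⟨hM, hc⟩
    obtain ⟨χ, hχ, hker⟩ := Ideal.exists_contractive_algHom M hM hc
    exact hker a (ha χ hχ)
  rwa [hA, Submodule.mem_bot] at this

theorem IsTractable.of_forall_algHom {B : Type*} [NormedCommRing B] [NormedAlgebra ℂ B]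
    (h : ∀ b : B, (∀ χ : B →ₐ[ℂ] ℂ, (∀ x, ‖χ x‖ ≤ ‖x‖) → χ b = 0) → b = 0) :
    IsTractable B := by
  refine eq_bot_iff.mpr fun b hb => h b fun χ hχ => ?_
  rw [Submodule.mem_sInf] at hb
  have hcont : Continuous χ :=
    AddMonoidHomClass.continuous_of_bound χ 1 fun x => by simpa using hχ x
  refine hb (RingHom.ker χ) ⟨RingHom.ker_isMaximal_of_surjective χ fun z =>
    ⟨algebraMap ℂ B z, by rw [AlgHom.commutes]; rfl⟩, ?_⟩
  exact isClosed_singleton.preimage hcont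

end Characters

/-! ### Discriminants and separable specializations -/

section Discriminant

theorem Polynomial.separable_map_of_discr_ne_zero {R K : Type*} [CommRing R] [Field K]
    (φ : R →+* K) {f : R[X]} (hf : f.Monic) (h : φ f.discr ≠ 0) : (f.map φ).Separable := by
  have : Nontrivial R := φ.domain_nontrivial
  rcases Nat.eq_zero_or_pos f.natDegree with h0 | hpos
  · rw [hf.natDegree_eq_zero.mp h0, Polynomial.map_one]
    exact separable_one
  have hres := congrArg φ (resultant_deriv (natDegree_pos_iff_degree_pos.mp hpos))
  rw [hf.leadingCoeff, mul_one, map_mul, ← resultant_map_map, ← derivative_map] at hres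
  -- The formal degrees `n` and `n - 1` of `f` are kept, so that the resultant commutes with `φ`. A
  -- nonzero resultant is a combination of the polynomial and its derivative.
  obtain ⟨p, q, -, -, hpq⟩ := exists_mul_add_mul_eq_C_resultant (f.map φ)
    (derivative (f.map φ)) (m := f.natDegree) (n := f.natDegree - 1) natDegree_map_le
    ((natDegree_derivative_le _).trans (Nat.sub_le_sub_right natDegree_map_le 1)) (Or.inl hpos.ne')
  set r := resultant (f.map φ) (derivative (f.map φ)) f.natDegree (f.natDegree - 1)
  have hr : r ≠ 0 := by
    rw [hres, map_pow, map_neg, map_one]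
    exact mul_ne_zero (pow_ne_zero _ (neg_ne_zero.mpr one_ne_zero)) h
  refine ⟨C r⁻¹ * p, C r⁻¹ * q, ?_⟩
  calc C r⁻¹ * p * f.map φ + C r⁻¹ * q * derivative (f.map φ)
      = C r⁻¹ * (f.map φ * p + derivative (f.map φ) * q) := by ring
    _ = 1 := by rw [hpq, ← C_mul, inv_mul_cancel₀ hr, C_1]

theorem Polynomial.map_eq_zero_of_forall_root {R : Type*} [CommRing R]
    (φ : R →+* ℂ) {f q : R[X]} (hf : f.Monic) (hq : q.degree < f.degree)
    (hsep : (f.map φ).Separable)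
    (h : ∀ z : ℂ, f.eval₂ φ z = 0 → q.eval₂ φ z = 0) : q.map φ = 0 := by
  by_contra hne
  have hdvd : (f.map φ) ∣ q.map φ := by
    rw [(IsAlgClosed.splits (f.map φ)).eq_prod_roots_of_monic (hf.map φ)]
    rw [Multiset.prod_X_sub_C_dvd_iff_le_roots hne]
    rw [Multiset.le_iff_subset (nodup_roots hsep)]
    intro z hz
    rw [mem_roots hne, IsRoot, eval_map]
    apply h
    have := isRoot_of_mem_roots hz
    rwa [IsRoot, eval_map] at this
  have h1 := degree_le_of_dvd hdvd hne
  rw [hf.degree_map] at h1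
  exact absurd (h1.trans degree_map_le) (not_le.mpr hq)

end Discriminant

/-! ### Algebra of standard extensions -/

namespace StandardExtension

section Algebraic

variable {A B : Type*} [CommRing A] [Algebra ℂ A] [CommRing B] [Algebra ℂ B] {θ : A →ₐ[ℂ] B}
  {U : Set A[X]} (E : StandardExtension θ U)

theorem induction {P : B → Prop} (base : ∀ a, P (θ a))
    (step : ∀ α : U, (∀ c ∈ lowerStage θ E.lt E.stage α, P c) → ∀ b ∈ E.stage α, P b) (b : B) :
    P b := by
  have := E.isWellOrder
  have key : ∀ α : U, ∀ b ∈ E.stage α, P b := by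
    intro α
    induction α using IsWellFounded.induction E.lt with
    | ind α ih =>
      refine step α fun c hc => ?_
      by_cases hα : ∃ β, E.lt β α
      · obtain ⟨β, hβ, hcβ⟩ :=
          (mem_lowerStage θ E.lt E.stage E.range_le_stage E.stage_mono α hα c).mp hc
        exact ih β hβ c hcβ
      · push Not at hα
        obtain ⟨a, rfl⟩ := (mem_lowerStage_least θ E.lt E.stage α hα c).mp hc
        exact base a
  have hb : b ∈ ⋃ α, (E.stage α : Set B) := by rw [E.iUnion_stage]; trivial
  obtain ⟨α, hα⟩ := Set.mem_iUnion.mp hb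
  exact key α b hα

/-- The subalgebra `A_α`. -/
abbrev lower (α : U) : Subalgebra ℂ B := lowerStage θ E.lt E.stage α

/-- The polynomial `α`, with coefficients in `A_α`. -/
noncomputable abbrev poly (α : U) : (E.lower α)[X] := lowerPoly θ E.lt E.stage α α.1

theorem lower_le_stage (α : U) : E.lower α ≤ E.stage α :=
  sup_le (E.range_le_stage α) (iSup_le fun β => E.stage_mono _ _ β.2)

theorem map_mem_lower (α : U) (a : A) : θ a ∈ E.lower α :=
  (le_sup_left : θ.range ≤ E.lower α) ⟨a, rfl⟩

theorem poly_monic (α : U) : (E.poly α).Monic := (E.monic α.1 α.2).map _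

theorem poly_map (α : U) {T : Type*} [CommRing T] (φ : B →+* T) :
    (E.poly α).map (φ.comp (E.lower α).val) = α.1.map (φ.comp θ) := by
  rw [poly, lowerPoly, Polynomial.map_map]
  rfl

theorem iso_lower (α : U) (a : E.lower α) :
    E.iso α ⟨a, E.lower_le_stage α a.2⟩ = AdjoinRoot.of (E.poly α) a :=
  E.iso_apply_lower α a _ rfl

/-- The element of `B_α` corresponding to the class of `x` in `A_α[x] / (α(x))`. -/
noncomputable def root (α : U) : B := ((E.iso α).symm (AdjoinRoot.root (E.poly α)) : E.stage α)

/-- Both sides are ring homomorphisms in `q` that agree on constants and on `X`. -/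
theorem iso_symm_mk (α : U) (q : (E.lower α)[X]) :
    ((E.iso α).symm (AdjoinRoot.mk (E.poly α) q) : B) =
      q.eval₂ ((E.lower α).val : E.lower α →+* B) (E.root α) := by
  have h : (((E.stage α).val : E.stage α →+* B).comp
      ((E.iso α).symm : AdjoinRoot (E.poly α) →+* E.stage α)).comp (AdjoinRoot.mk (E.poly α)) =
      eval₂RingHom ((E.lower α).val : E.lower α →+* B) (E.root α) := by
    refine Polynomial.ringHom_ext (fun a => ?_) ?_
    · have h1 := E.iso_lower α a
      rw [← AlgEquiv.eq_symm_apply] at h1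
      rw [coe_eval₂RingHom, eval₂_C]
      exact (congrArg Subtype.val h1).symm
    · rw [coe_eval₂RingHom, eval₂_X]
      rfl
  exact RingHom.congr_fun h q

theorem eval₂_root (α : U) : α.1.eval₂ (θ : A →+* B) (E.root α) = 0 := by
  have h := E.iso_symm_mk α (E.poly α)
  rw [AdjoinRoot.mk_self, map_zero, ← eval_map] at h
  have h2 := E.poly_map α (RingHom.id B)
  rw [RingHom.id_comp, RingHom.id_comp] at h2
  rw [h2, eval_map] at h
  exact h.symm

theorem eq_eval₂_root_of_iso {α : U} {b : B} (hb : b ∈ E.stage α) {q : (E.lower α)[X]}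
    (h : AdjoinRoot.mk (E.poly α) q = E.iso α ⟨b, hb⟩) :
    b = q.eval₂ ((E.lower α).val : E.lower α →+* B) (E.root α) := by
  rw [← E.iso_symm_mk, h, AlgEquiv.symm_apply_apply]

theorem exists_eq_eval₂_root [Nontrivial B] {α : U} {b : B} (hb : b ∈ E.stage α) :
    ∃ q : (E.lower α)[X], q.degree < (E.poly α).degree ∧
      b = q.eval₂ ((E.lower α).val : E.lower α →+* B) (E.root α) := by
  obtain ⟨p, hp⟩ := AdjoinRoot.mk_surjective (E.iso α ⟨b, hb⟩)
  refine ⟨p %ₘ E.poly α, degree_modByMonic_lt p (E.poly_monic α), E.eq_eval₂_root_of_iso hb ?_⟩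
  rw [← hp, AdjoinRoot.mk_eq_mk, modByMonic_eq_sub_mul_div]
  simp

theorem eq_zero_of_eval₂_root_eq_zero {α : U} {q : (E.lower α)[X]}
    (hq : q.degree < (E.poly α).degree)
    (h : q.eval₂ ((E.lower α).val : E.lower α →+* B) (E.root α) = 0) : q = 0 := by
  rw [← E.iso_symm_mk, ZeroMemClass.coe_eq_zero, map_eq_zero_iff _ (AlgEquiv.injective _),
    AdjoinRoot.mk_eq_zero] at h
  by_contra hne
  exact (E.poly_monic α).not_dvd_of_degree_lt hne hq h

end Algebraic

section Algebraic

variable {A B : Type*} [CommRing A] [Algebra ℂ A] [CommRing B] [Algebra ℂ B] {θ : A →ₐ[ℂ] B}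
  {U : Set A[X]}

theorem isIntegral [Nontrivial B] (E : StandardExtension θ U) : (θ : A →+* B).IsIntegral := by
  intro b
  refine E.induction (P := (θ : A →+* B).IsIntegralElem)
    (fun a => (θ : A →+* B).isIntegralElem_map) (fun α hα b hb => ?_) b
  have hroot : (θ : A →+* B).IsIntegralElem (E.root α) :=
    ⟨α.1, E.monic α.1 α.2, E.eval₂_root α⟩
  obtain ⟨q, -, rfl⟩ := E.exists_eq_eval₂_root hb
  let _ : Algebra A B := (θ : A →+* B).toAlgebra
  rw [eval₂_eq_sum_range]
  exact IsIntegral.sum (R := A) _ fun k _ =>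
    IsIntegral.mul (hα _ (q.coeff k).2) (IsIntegral.pow hroot k)

theorem isIntegral_stage [Nontrivial B] (E : StandardExtension θ U) (α : U) :
    ((E.stage α).val : E.stage α →+* B).IsIntegral := by
  have h : (θ : A →+* B) = ((E.stage α).val : E.stage α →+* B).comp
      (θ.codRestrict (E.stage α) fun a => E.range_le_stage α ⟨a, rfl⟩ : A →+* E.stage α) := rfl
  refine RingHom.IsIntegral.tower_top _ _ (h ▸ E.isIntegral)

/-- Powers of `root α` below the degree are independent over `A_α`, so cancellation can be done
coefficientwise. -/
theorem mul_eq_zero_of_mem_nonZeroDivisors [Nontrivial B] (E : StandardExtension θ U) {d : A}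
    (hd : d ∈ nonZeroDivisors A) (b : B) (hb : θ d * b = 0) : b = 0 := by
  revert hb
  refine E.induction (P := fun b => θ d * b = 0 → b = 0) (fun a ha => ?_) (fun α hα b hb h => ?_) b
  · rw [← map_mul, map_eq_zero_iff θ E.injective] at ha
    rw [(mem_nonZeroDivisors_iff.mp hd).1 a ha, map_zero]
  · obtain ⟨q, hq, rfl⟩ := E.exists_eq_eval₂_root hb
    have h0 : C (⟨θ d, E.map_mem_lower α d⟩ : E.lower α) * q = 0 := by
      refine E.eq_zero_of_eval₂_root_eq_zero ((degree_mul_le _ _).trans_lt ?_) ?_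
      · exact (add_le_add_left degree_C_le _).trans_lt (by simpa using hq)
      rw [eval₂_mul, eval₂_C]
      exact h
    have hq0 : q = 0 := by
      ext k
      refine hα _ (q.coeff k).2 ?_
      have := congrArg (fun p : (E.lower α)[X] => ((p.coeff k : E.lower α) : B)) h0
      simpa [coeff_C_mul] using this
    rw [hq0, eval₂_zero]

/-- A character of `B` can be modified on `B_α`, keeping its values on `A_α`, so that `root α` is
sent to any prescribed root of the image of `α`. -/
theorem exists_algHom_root_eq [Nontrivial B] (E : StandardExtension θ U) (α : U) (ψ : B →ₐ[ℂ] ℂ)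
    {z : ℂ} (hz : (E.poly α).eval₂ ((ψ : B →+* ℂ).comp (E.lower α).val) z = 0) :
    ∃ ψ' : B →ₐ[ℂ] ℂ, (∀ c ∈ E.lower α, ψ' c = ψ c) ∧ ψ' (E.root α) = z := by
  -- Sending `x` to `z` defines a character of `B_α`, over which `B` is integral.
  obtain ⟨ψ', hψ'⟩ := AlgHom.exists_extension_of_isIntegral (E.stage α).val
    Subtype.val_injective (E.isIntegral_stage α)
    ((AdjoinRoot.liftAlgHom (E.poly α) (ψ.comp (E.lower α).val) z hz).comp
      (E.iso α : E.stage α →ₐ[ℂ] AdjoinRoot (E.poly α)))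
  refine ⟨ψ', fun c hc => ?_, ?_⟩
  · refine (hψ' ⟨c, E.lower_le_stage α hc⟩).trans ?_
    change AdjoinRoot.liftAlgHom (E.poly α) _ z hz (E.iso α ⟨c, _⟩) = _
    rw [E.iso_lower α ⟨c, hc⟩]
    exact AdjoinRoot.liftAlgHom_of (E.poly α) (ψ.comp (E.lower α).val) z hz ⟨c, hc⟩
  · refine (hψ' ((E.iso α).symm (AdjoinRoot.root (E.poly α)))).trans ?_
    change AdjoinRoot.liftAlgHom (E.poly α) _ z hz (E.iso α _) = _
    rw [AlgEquiv.apply_symm_apply]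
    exact AdjoinRoot.liftAlgHom_root (E.poly α) (ψ.comp (E.lower α).val) z hz

theorem eq_zero_of_forall_algHom [Nontrivial B] (E : StandardExtension θ U)
    (hdiscr : ∀ α ∈ U, α.discr ∈ nonZeroDivisors A) (X : Set (A →ₐ[ℂ] ℂ))
    (hX : ∀ a, (∀ χ ∈ X, χ a = 0) → a = 0) (b : B)
    (hb : ∀ ψ : B →ₐ[ℂ] ℂ, ψ.comp θ ∈ X → ψ b = 0) : b = 0 := by
  revert hb
  refine E.induction (P := fun b => (∀ ψ : B →ₐ[ℂ] ℂ, ψ.comp θ ∈ X → ψ b = 0) → b = 0)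
    (fun a ha => ?_) (fun α hα b hb h => ?_) b
  · rw [hX a fun χ hχ => ?_, map_zero]
    obtain ⟨ψ, hψ⟩ := AlgHom.exists_extension_of_isIntegral θ E.injective E.isIntegral χ
    rw [← hψ]
    exact ha ψ (by rwa [show ψ.comp θ = χ from AlgHom.ext hψ])
  · obtain ⟨q, hq, rfl⟩ := E.exists_eq_eval₂_root hb
    suffices hq0 : q = 0 by rw [hq0, eval₂_zero]
    ext k
    -- The factor `discr α` disposes of the characters for which separability may fail.
    refine E.mul_eq_zero_of_mem_nonZeroDivisors (hdiscr α.1 α.2) _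
      (hα _ (mul_mem (E.map_mem_lower α _) (q.coeff k).2) fun ψ hψ => ?_)
    rw [map_mul, mul_eq_zero, or_iff_not_imp_left]
    intro hne
    have hsep : ((E.poly α).map ((ψ : B →+* ℂ).comp (E.lower α).val)).Separable := by
      rw [E.poly_map]
      exact separable_map_of_discr_ne_zero _ (E.monic α.1 α.2) hne
    have hmap := map_eq_zero_of_forall_root _ (E.poly_monic α) hq hsep fun z hz => by
      obtain ⟨ψ', hlow, hroot⟩ := E.exists_algHom_root_eq α ψ hz
      have h0 := h ψ' (by
        rwa [show ψ'.comp θ = ψ.comp θ from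
          AlgHom.ext fun a => hlow _ (E.map_mem_lower α a)])
      rw [← AlgHom.coe_toRingHom, hom_eval₂, AlgHom.coe_toRingHom, hroot] at h0
      rwa [show (ψ' : B →+* ℂ).comp ((E.lower α).val : E.lower α →+* B) =
        (ψ : B →+* ℂ).comp (E.lower α).val from RingHom.ext fun c => hlow c c.2] at h0
    have := congrArg (fun p : ℂ[X] => p.coeff k) hmap
    simpa [coeff_map] using this

end Algebraic

end StandardExtension

/-! ### Contractivity of extended characters -/

/-- If `w > t`, passing from `t` to `w` multiplies each term of the sum by at most `(w / t) ^ (n -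
1)`, but `t ^ n` by `(w / t) ^ n`. -/
theorem le_of_pow_le_sum (n : ℕ) (c : ℕ → ℝ) (hc : ∀ k, 0 ≤ c k) {t w : ℝ} (ht : 0 < t)
    (hsum : ∑ k ∈ Finset.range n, c k * t ^ k ≤ t ^ n)
    (hw : w ^ n ≤ ∑ k ∈ Finset.range n, c k * w ^ k) : w ≤ t := by
  rcases n with _ | n
  · simp at hw
    exact absurd hw (by norm_num)
  by_contra! hlt
  have hone : 1 < w / t := (one_lt_div ht).mpr hlt
  have hwt : w = w / t * t := (div_mul_cancel₀ w ht.ne').symm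
  have h1 : ∑ k ∈ Finset.range (n + 1), c k * w ^ k ≤
      (w / t) ^ n * ∑ k ∈ Finset.range (n + 1), c k * t ^ k := by
    rw [Finset.mul_sum]
    refine Finset.sum_le_sum fun k hk => ?_
    have hkn : (w / t) ^ k ≤ (w / t) ^ n :=
      pow_le_pow_right₀ hone.le (Nat.lt_succ_iff.mp (Finset.mem_range.mp hk))
    calc c k * w ^ k = (w / t) ^ k * (c k * t ^ k) := by
          nth_rewrite 1 [hwt]
          ring
      _ ≤ _ := mul_le_mul_of_nonneg_right hkn (mul_nonneg (hc k) (by positivity))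
  have h2 : (w / t) ^ n * t ^ (n + 1) < w ^ (n + 1) := by
    nth_rewrite 2 [hwt]
    rw [mul_pow]
    exact mul_lt_mul_of_pos_right (pow_lt_pow_right₀ hone n.lt_succ_self) (by positivity)
  exact absurd hw (not_le.mpr ((h1.trans
    (mul_le_mul_of_nonneg_left hsum (by positivity))).trans_lt h2))

theorem StandardNormedExtension.norm_algHom_le {A B : Type*} [NormedCommRing A]
    [NormedAlgebra ℂ A] [NormedCommRing B] [NormedAlgebra ℂ B] [Nontrivial B] {θ : A →ₐ[ℂ] B}
    {U : Set A[X]} (E : StandardNormedExtension θ U) (ψ : B →ₐ[ℂ] ℂ)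
    (hψ : ∀ a, ‖ψ (θ a)‖ ≤ ‖a‖) (b : B) : ‖ψ b‖ ≤ ‖b‖ := by
  refine E.toStandardExtension.induction (P := fun b => ‖ψ b‖ ≤ ‖b‖) (fun a => ?_)
    (fun α hα b hb => ?_) b
  · exact (hψ a).trans (E.isometry.norm_map_of_map_zero (map_zero θ) a).ge
  · obtain ⟨ht, hsum⟩ := E.isParameter α
    have hroot : ‖ψ (E.root α)‖ ≤ E.parameter α := by
      refine le_of_pow_le_sum (E.poly α).natDegree (fun k => ‖(E.poly α).coeff k‖)
        (fun k => norm_nonneg _) ht hsum ?_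
      have h0 := congrArg ψ (E.eq_eval₂_root_of_iso (b := 0) (zero_mem _) (q := E.poly α)
        (by rw [AdjoinRoot.mk_self]; exact (map_zero (E.iso α)).symm))
      rw [map_zero, eval₂_eq_sum_range, Finset.sum_range_succ,
        (E.poly_monic α).coeff_natDegree, map_one, one_mul, map_add, eq_comm,
        add_comm, ← eq_neg_iff_add_eq_zero] at h0
      rw [← norm_pow, ← map_pow, h0, norm_neg, map_sum]
      refine norm_sum_le_of_le _ fun k _ => ?_
      rw [map_mul, norm_mul, map_pow, norm_pow]
      exact mul_le_mul_of_nonneg_right (hα _ ((E.poly α).coeff k).2) (by positivity)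
    rw [← E.norm_iso α ⟨b, hb⟩, arensHoffmanNorm]
    obtain ⟨p₀, hp₀⟩ := AdjoinRoot.mk_surjective (E.iso α ⟨b, hb⟩)
    have : Nonempty {p : (E.lower α)[X] //
      AdjoinRoot.mk (E.poly α) p = E.iso α ⟨b, hb⟩} := ⟨⟨p₀, hp₀⟩⟩
    -- The norm is an infimum over all representatives, so each is estimated, not only the reduced
    -- one.
    refine le_ciInf fun ⟨p, hp⟩ => ?_
    have hbp := congrArg ψ (E.eq_eval₂_root_of_iso hb hp)
    rw [eval₂_eq_sum, Polynomial.sum, map_sum] at hbp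
    rw [hbp, weightedPolyNorm]
    refine norm_sum_le_of_le _ fun k _ => ?_
    rw [map_mul, norm_mul, map_pow, norm_pow]
    exact mul_le_mul (hα _ (p.coeff k).2) (pow_le_pow_left₀ (norm_nonneg _) hroot k)
      (by positivity) (norm_nonneg _)

theorem theorem5p12 {A B : Type*} [NormedCommRing A] [NormedAlgebra ℂ A] [NormOneClass A]
    [NormedCommRing B] [NormedAlgebra ℂ B] [NormOneClass B] (θ : A →ₐ[ℂ] B)
    (U : Set (Polynomial A)) (E : StandardNormedExtension θ U)
    (hdiscr : ∀ α ∈ U, α.discr ≠ 0 ∧ α.discr ∈ nonZeroDivisors A)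
    (hA : IsTractable A) : IsTractable B := by
  have : Nontrivial B := NormOneClass.nontrivial
  refine .of_forall_algHom fun b hb => E.toStandardExtension.eq_zero_of_forall_algHom
    (fun α hα => (hdiscr α hα).2) {χ | ∀ x, ‖χ x‖ ≤ ‖x‖}
    (fun a ha => hA.eq_zero_of_forall_algHom a ha) b fun ψ hψ => ?_
  exact hb ψ (E.norm_algHom_le ψ hψ)
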